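/- Let $n$ be a natural number, let $u:\mathbb{R}^n\to\mathbb{R}$ be a $C^\infty$ function, and let $M=\{(x,u(x)) : x\in\mathbb{R}^n\}\subset\mathbb{R}^{n+1}$ be its graph, with the induced Riemannian metric and measure $dM$. For a smooth unit normal field $N$ on $M$ let $A(v)=-D_vN$ be the shape operator, let $\lambda_1,\dots,\lambda_n$ be its eigenvalues, let $S_r=\sum_{i_1<\dots<i_r}\lambda_{i_1}\cdots\lambda_{i_r}$ (so $S_r=0$ for $r>n$), and let $P_1=S_1I-A$. If $S_2=0$ on $M$, then $M$, oriented by $N$, is called stable if $$\int_M\langle P_1(\nabla f),\nabla f\rangle\,dM\ \ge\ -3\int_M S_3f^2\,dM\qquad\text{for all } f\in C_c^\infty(M).$$ If $S_2$ is a nonzero constant on $M$, then $M$, oriented by $N$, is called strongly stable if $$\int_M\langle P_1(\nabla f),\nabla f\rangle\,dM\ \ge\ \int_M (S_1S_2-3S_3)f^2\,dM\qquad\text{for all } f\in C_c^\infty(M).$$ Replacing $N$ by $-N$ changes the signs of $S_1$, $S_3$ and $P_1$ and leaves $S_2$ unchanged. Then: 1. If $S_2=0$ on $M$ and $S_1$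 does not change sign on $M$ (that is, $S_1\ge 0$ everywhere or $S_1\le 0$ everywhere), then the orientation of $M$ can be chosen so that $S_1\ge 0$ and $M$ is stable. 2. If $S_2=C$ on $M$ for a constant $C>0$, then the orientation of $M$ can be chosen so that $S_1\ge 0$ and $M$ is strongly stable. -/

import Mathlib

open MeasureTheory
open scoped ContDiff Matrix

noncomputable section

namespace GraphStability

/-- Euclidean space of dimension `n`. -/
abbrev Euc (n : ℕ) : Type := EuclideanSpace ℝ (Fin n)

/-- The global parametrization `x ↦ (x, u x)` of the graph of `u : ℝⁿ → ℝ` in `ℝⁿ⁺¹`. -/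
def graphMap {n : ℕ} (u : Euc n → ℝ) (x : Euc n) : Euc (n + 1) :=
  WithLp.toLp 2 (Fin.snoc (α := fun _ => ℝ) (fun i => x i) (u x))

/-- The `i`-th partial derivative of a map on `ℝⁿ`. -/
def partialD {n : ℕ} {F : Type*} [NormedAddCommGroup F] [NormedSpace ℝ F]
    (i : Fin n) (f : Euc n → F) (x : Euc n) : F :=
  fderiv ℝ f x (EuclideanSpace.single i 1)

/-- `N` is a smooth unit normal vector field along the hypersurface parametrized by `X`. -/
structure IsUnitNormalField {n : ℕ} (X N : Euc n → Euc (n + 1)) : Prop where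
  smooth : ContDiff ℝ ∞ N
  norm_eq_one : ∀ x, ‖N x‖ = 1
  normal : ∀ x v, inner ℝ (N x) (fderiv ℝ X x v) = 0

/-- The induced metric `g i j = ⟨∂ᵢX, ∂ⱼX⟩`. -/
def metric {n : ℕ} (X : Euc n → Euc (n + 1)) (x : Euc n) : Matrix (Fin n) (Fin n) ℝ :=
  Matrix.of fun i j => inner ℝ (partialD i X x) (partialD j X x)

/-- The second fundamental form `h i j = ⟨∂ᵢX, -∂ⱼN⟩`. -/
def secondForm {n : ℕ} (X N : Euc n → Euc (n + 1)) (x : Euc n) : Matrix (Fin n) (Fin n) ℝ :=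
  Matrix.of fun i j => inner ℝ (partialD i X x) (-partialD j N x)

/-- The matrix, in the coordinate frame `∂₁X, …, ∂ₙX`, of the operator `A(v) = -D_v N`
on the tangent space: `∑ i, A i j • ∂ᵢX = -∂ⱼN`, that is, `g * A = h`. -/
def shapeOp {n : ℕ} (X N : Euc n → Euc (n + 1)) (x : Euc n) : Matrix (Fin n) (Fin n) ℝ :=
  (metric X x)⁻¹ * secondForm X N x

/-- The multiset of the eigenvalues `λ₁, …, λₙ` of `A`, with multiplicity
(they are all real, since `A` is self-adjoint for the induced metric). -/
def principalCurvatures {n : ℕ} (X N : Euc n → Euc (n + 1)) (x : Euc n) : Multiset ℝ :=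
  (shapeOp X N x).charpoly.roots

/-- `S_r`, the `r`-th elementary symmetric function of the eigenvalues of `A`
(it is `0` for `r > n`). -/
def symCurv {n : ℕ} (r : ℕ) (X N : Euc n → Euc (n + 1)) (x : Euc n) : ℝ :=
  (principalCurvatures X N x).esymm r

/-- The Newton transformations `P₀ = I`, `P_r = S_r I - A P_{r-1}`, in the coordinate frame. -/
def newton {n : ℕ} (X N : Euc n → Euc (n + 1)) (x : Euc n) : ℕ → Matrix (Fin n) (Fin n) ℝ
  | 0 => 1
  | r + 1 => symCurv (r + 1) X N x • (1 : Matrix (Fin n) (Fin n) ℝ)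
      - shapeOp X N x * newton X N x r

/-- The components `g^{ij} ∂ⱼf` of the gradient of `f` for the induced metric. -/
def grad {n : ℕ} (X : Euc n → Euc (n + 1)) (f : Euc n → ℝ) (x : Euc n) : Fin n → ℝ :=
  (metric X x)⁻¹ *ᵥ fun j => partialD j f x

/-- The induced inner product `⟨v, w⟩` of tangent vectors given by their components. -/
def metricInner {n : ℕ} (X : Euc n → Euc (n + 1)) (x : Euc n) (v w : Fin n → ℝ) : ℝ :=
  v ⬝ᵥ (metric X x *ᵥ w)

/-- The Riemannian measure `dM = √(det g) dx` of the induced metric. -/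
def areaMeasure {n : ℕ} (X : Euc n → Euc (n + 1)) : Measure (Euc n) :=
  volume.withDensity fun x => ENNReal.ofReal (Real.sqrt (metric X x).det)

/-- The quadratic form `∫_M ⟨P₁(∇f), ∇f⟩ dM`. -/
def newtonEnergy {n : ℕ} (X N : Euc n → Euc (n + 1)) (f : Euc n → ℝ) : ℝ :=
  ∫ x, metricInner X x (newton X N x 1 *ᵥ grad X f x) (grad X f x) ∂(areaMeasure X)

/-- Stability of a hypersurface of Euclidean space with `S₂ = 0`, oriented by `N`.
Functions on the hypersurface are read in the global parametrization `X`. -/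
def IsStable {n : ℕ} (X N : Euc n → Euc (n + 1)) : Prop :=
  ∀ f : Euc n → ℝ, ContDiff ℝ ∞ f → HasCompactSupport f →
    newtonEnergy X N f ≥ -3 * ∫ x, symCurv 3 X N x * f x ^ 2 ∂(areaMeasure X)

/-- Strong stability of a hypersurface of Euclidean space with `S₂` a nonzero constant,
oriented by `N`. -/
def IsStronglyStable {n : ℕ} (X N : Euc n → Euc (n + 1)) : Prop :=
  ∀ f : Euc n → ℝ, ContDiff ℝ ∞ f → HasCompactSupport f →
    newtonEnergy X N f ≥
      ∫ x, (symCurv 1 X N x * symCurv 2 X N x - 3 * symCurv 3 X N x) * f x ^ 2 ∂(areaMeasure X)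

end GraphStability

end

namespace GraphStability

/-! The vertical component `ν` of `N` never vanishes on a graph and solves the Jacobi equation of
the stability form. As for any operator with a nowhere zero Jacobi function, the form is then
nonnegative, provided `P₁ ≥ 0`.

All of this is done in the flat coordinates of `ℝⁿ`. Let `q` be the horizontal part of `-N`, and `W`
the area density. Since `∂ᵢX = (eᵢ, ∂ᵢu)`, horizontal components are frame components, so `A` is the
Jacobian matrix of `q` (`shapeOp_graphMap`). For constant `S₂`, the field `Y = P₁Aq` has flat
divergence `S₁S₂ - 3S₃` (`sum_partialD_newtonField`), and `P₁∇ν = -νY`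
(`newtonForm_mulVec_vertical`). As `νW = ±1` is constant, these two facts together are the Jacobi
equation.

Integrating `f²W div Y` by parts leaves the pointwise inequality `-∂(f²W)·Y ≤ W⟨P₁∇f, ∇f⟩`, which is
`⟨P₁(∇f - (f/ν)∇ν), ∇f - (f/ν)∇ν⟩ ≥ 0`. Positivity of `P₁` follows from `S₁ ≥ 0` and `S₂ ≥ 0`. For
`S₂ = 0` the potential is `-3S₃`, so both claims are one inequality; for `S₂ > 0` the sign of `S₁`
is automatic. -/

/-! ### Linear algebra of a pair `(g, h)`: Newton's identities, diagonalization, positivity of `P₁`.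
-/

open Finset in
theorem esymm_one_map {n : ℕ} (l : Fin n → ℝ) :
    ((univ : Finset (Fin n)).val.map l).esymm 1 = ∑ i, l i := by
  rw [← MvPolynomial.aeval_esymm_eq_multiset_esymm (Fin n) ℝ, MvPolynomial.esymm_one]
  simp

open Finset in
theorem two_mul_esymm_two_map {n : ℕ} (l : Fin n → ℝ) :
    2 * ((univ : Finset (Fin n)).val.map l).esymm 2 = (∑ i, l i) ^ 2 - ∑ i, l i ^ 2 := by
  have h := congrArg (MvPolynomial.eval l) (MvPolynomial.mul_esymm_eq_sum (Fin n) ℝ 2)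
  have hs : ((antidiagonal 2).filter fun a : ℕ × ℕ => a.1 < 2) = {(0, 2), (1, 1)} := by decide
  rw [hs] at h
  simp only [← MvPolynomial.aeval_esymm_eq_multiset_esymm (Fin n) ℝ]
  simp [MvPolynomial.psum] at h
  simp only [MvPolynomial.aeval_eq_eval]
  linarith

-- Newton's identity in degree three, with `e₂` left unexpanded because the goal is the potential
-- `e₁e₂ - 3e₃`.
open Finset in
theorem three_mul_esymm_three_map {n : ℕ} (l : Fin n → ℝ) :
    3 * ((univ : Finset (Fin n)).val.map l).esymm 3 =
      (∑ i, l i) * ((univ : Finset (Fin n)).val.map l).esymm 2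
        - (∑ i, l i) * ∑ i, l i ^ 2 + ∑ i, l i ^ 3 := by
  have h := congrArg (MvPolynomial.eval l) (MvPolynomial.mul_esymm_eq_sum (Fin n) ℝ 3)
  have hs : ((antidiagonal 3).filter fun a : ℕ × ℕ => a.1 < 3) =
    {(0, 3), (1, 2), (2, 1)} := by decide
  rw [hs] at h
  simp only [← MvPolynomial.aeval_esymm_eq_multiset_esymm (Fin n) ℝ]
  simp [MvPolynomial.psum] at h
  simp only [MvPolynomial.aeval_eq_eval]
  linarith

open scoped MatrixOrder in
/-- Simultaneous diagonalization of a positive definite and a symmetric matrix. -/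
theorem exists_simultaneous_diagonalization {n : ℕ} {g h : Matrix (Fin n) (Fin n) ℝ}
    (hg : g.PosDef) (hh : hᵀ = h) :
    ∃ (Q : Matrix (Fin n) (Fin n) ℝ) (l : Fin n → ℝ),
      Qᵀ * g * Q = 1 ∧ Qᵀ * h * Q = Matrix.diagonal l := by
  -- Passing to the basis `R⁻¹` makes `g` the identity; an orthogonal `V` then diagonalizes the
  -- transformed `h`, so `Q = R⁻¹V`.
  obtain ⟨R, hR, rfl⟩ : ∃ R : Matrix (Fin n) (Fin n) ℝ, IsUnit R ∧ g = Rᵀ * R := by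
    have := (CStarAlgebra.isStrictlyPositive_iff_eq_star_mul_self (a := g)).mp hg.isStrictlyPositive
    simpa [Matrix.star_eq_conjTranspose] using this
  have hRd : IsUnit R.det := (Matrix.isUnit_iff_isUnit_det R).mp hR
  have hk : ((R⁻¹)ᵀ * h * R⁻¹).IsHermitian := by
    simp [Matrix.IsHermitian, Matrix.transpose_mul, hh, Matrix.mul_assoc]
  obtain ⟨V, hV⟩ : ∃ V : Matrix (Fin n) (Fin n) ℝ, V = hk.eigenvectorUnitary.1 := ⟨_, rfl⟩
  have hU : Vᵀ * V = 1 := by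
    have := Matrix.mem_unitaryGroup_iff'.mp hk.eigenvectorUnitary.2
    simpa [Matrix.star_eq_conjTranspose, ← hV] using this
  have hs := hk.conjStarAlgAut_star_eigenvectorUnitary
  rw [Unitary.conjStarAlgAut_star_apply] at hs
  refine ⟨R⁻¹ * V, hk.eigenvalues, ?_, ?_⟩
  · have h1 : R * R⁻¹ = 1 := Matrix.mul_nonsing_inv R hRd
    calc (R⁻¹ * V)ᵀ * (Rᵀ * R) * (R⁻¹ * V) = Vᵀ * (R * R⁻¹)ᵀ * (R * R⁻¹) * V := by
          simp only [Matrix.transpose_mul, Matrix.mul_assoc]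
      _ = 1 := by simp [h1, hU]
  · calc (R⁻¹ * V)ᵀ * h * (R⁻¹ * V) = Vᵀ * ((R⁻¹)ᵀ * h * R⁻¹) * V := by
          simp only [Matrix.transpose_mul, Matrix.mul_assoc]
      _ = Matrix.diagonal hk.eigenvalues := by
          simpa [Matrix.star_eq_conjTranspose, ← hV] using hs

theorem trace_conj_diagonal_pow {n : ℕ} {Q R : Matrix (Fin n) (Fin n) ℝ} (h : R * Q = 1)
    (l : Fin n → ℝ) (k : ℕ) :
    ((Q * Matrix.diagonal l * R) ^ k).trace = ∑ i, l i ^ k := by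
  have hp : (Q * Matrix.diagonal l * R) ^ k = Q * Matrix.diagonal l ^ k * R := by
    induction k with
    | zero => simp [mul_eq_one_comm.mp h]
    | succ k ih =>
      rw [pow_succ, ih, pow_succ]
      calc Q * Matrix.diagonal l ^ k * R * (Q * Matrix.diagonal l * R)
          = Q * Matrix.diagonal l ^ k * (R * Q) * Matrix.diagonal l * R := by
            simp only [Matrix.mul_assoc]
        _ = _ := by rw [h]; simp only [Matrix.mul_assoc, Matrix.one_mul]
  rw [hp, Matrix.trace_mul_comm, ← Matrix.mul_assoc, h, Matrix.one_mul, Matrix.diagonal_pow,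
    Matrix.trace_diagonal]
  rfl

theorem roots_charpoly_conj_diagonal {n : ℕ} {Q R : Matrix (Fin n) (Fin n) ℝ} (h : R * Q = 1)
    (l : Fin n → ℝ) :
    (Q * Matrix.diagonal l * R).charpoly.roots = (Finset.univ : Finset (Fin n)).val.map l := by
  rw [Matrix.charpoly_mul_comm, ← Matrix.mul_assoc, h, Matrix.one_mul, Matrix.charpoly_diagonal,
    Polynomial.roots_prod _ _ (by simp [Finset.prod_ne_zero_iff, Polynomial.X_sub_C_ne_zero])]
  simp

/-- The shape operator `g⁻¹ h` is diagonalizable by a `g`-orthonormal frame. -/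
theorem exists_frame {n : ℕ} {g h : Matrix (Fin n) (Fin n) ℝ} (hg : g.PosDef) (hh : hᵀ = h) :
    ∃ (Q : Matrix (Fin n) (Fin n) ℝ) (l : Fin n → ℝ), (Qᵀ * g) * Q = 1 ∧ g⁻¹ = Q * Qᵀ ∧
      g⁻¹ * h = Q * Matrix.diagonal l * (Qᵀ * g) := by
  obtain ⟨Q, l, h1, h2⟩ := exists_simultaneous_diagonalization hg hh
  have h3 : Q * (Qᵀ * g) = 1 := mul_eq_one_comm.mp h1
  have hinv : g⁻¹ = Q * Qᵀ := Matrix.inv_eq_left_inv (by rw [Matrix.mul_assoc, h3])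
  refine ⟨Q, l, h1, hinv, ?_⟩
  rw [← h2, hinv]
  calc Q * Qᵀ * h = Q * Qᵀ * h * (Q * (Qᵀ * g)) := by rw [h3, Matrix.mul_one]
    _ = _ := by simp only [Matrix.mul_assoc]

section Pencil

variable {n : ℕ} {g h A : Matrix (Fin n) (Fin n) ℝ}

theorem esymm_one_eq_trace (hg : g.PosDef) (hh : hᵀ = h) (hA : A = g⁻¹ * h) :
    A.charpoly.roots.esymm 1 = A.trace := by
  obtain ⟨Q, l, h1, -, h3⟩ := exists_frame hg hh
  have t1 := trace_conj_diagonal_pow h1 l 1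
  simp only [pow_one] at t1
  rw [hA, h3, roots_charpoly_conj_diagonal h1, t1, esymm_one_map]

theorem two_mul_esymm_two_eq_trace (hg : g.PosDef) (hh : hᵀ = h) (hA : A = g⁻¹ * h) :
    2 * A.charpoly.roots.esymm 2 = A.trace ^ 2 - (A * A).trace := by
  obtain ⟨Q, l, h1, -, h3⟩ := exists_frame hg hh
  have t1 := trace_conj_diagonal_pow h1 l 1
  have t2 := trace_conj_diagonal_pow h1 l 2
  simp only [pow_one] at t1
  rw [hA, h3, roots_charpoly_conj_diagonal h1, ← pow_two, t1, t2, two_mul_esymm_two_map]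

/-- The trace form of the potential is the one that the divergence of `newtonField` produces. -/
theorem esymm_potential_eq_trace (hg : g.PosDef) (hh : hᵀ = h) (hA : A = g⁻¹ * h) :
    A.charpoly.roots.esymm 1 * A.charpoly.roots.esymm 2 - 3 * A.charpoly.roots.esymm 3
      = A.trace * (A * A).trace - (A * A * A).trace := by
  obtain ⟨Q, l, h1, -, h3⟩ := exists_frame hg hh
  have t1 := trace_conj_diagonal_pow h1 l 1
  have t2 := trace_conj_diagonal_pow h1 l 2
  have t3 := trace_conj_diagonal_pow h1 l 3
  simp only [pow_one] at t1
  rw [hA, h3, roots_charpoly_conj_diagonal h1, ← pow_two, ← pow_succ, t1, t2, t3,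
    three_mul_esymm_three_map, esymm_one_map]
  ring

theorem trace_mul_self_nonneg (hg : g.PosDef) (hh : hᵀ = h) (hA : A = g⁻¹ * h) :
    0 ≤ (A * A).trace := by
  obtain ⟨Q, l, h1, -, h3⟩ := exists_frame hg hh
  have t2 := trace_conj_diagonal_pow h1 l 2
  rw [hA, h3, ← pow_two, t2]
  positivity

/-- The first Newton transformation is nonnegative where `S₁ ≥ 0` and `S₂ ≥ 0`. -/
theorem posSemidef_newton_one (hg : g.PosDef) (hh : hᵀ = h) (hA : A = g⁻¹ * h)
    (h1 : 0 ≤ A.charpoly.roots.esymm 1) (h2 : 0 ≤ A.charpoly.roots.esymm 2) :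
    ((A.charpoly.roots.esymm 1 • 1 - A) * g⁻¹).PosSemidef := by
  obtain ⟨Q, l, hQ, hi, hd⟩ := exists_frame hg hh
  rw [hA, hd, roots_charpoly_conj_diagonal hQ] at h1 h2 ⊢
  have e2 := two_mul_esymm_two_map l
  rw [esymm_one_map] at h1 ⊢
  -- The eigenvalues of `P₁` are `S₁ - lᵢ`, and `lᵢ² ≤ ∑ lⱼ² = S₁² - 2S₂ ≤ S₁²`.
  have hl : ∀ i, 0 ≤ (∑ j, l j) - l i := fun i => by
    have := Finset.single_le_sum (f := fun j => l j ^ 2) (fun j _ => sq_nonneg (l j))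
      (Finset.mem_univ i)
    have hsq : l i ^ 2 ≤ (∑ j, l j) ^ 2 := by linarith
    linarith [(abs_le_of_sq_le_sq' hsq h1).2]
  have hgi : g * (Q * Qᵀ) = 1 := by
    rw [← hi]; exact Matrix.mul_nonsing_inv g ((Matrix.isUnit_iff_isUnit_det g).mp hg.isUnit)
  have key : ((∑ j, l j) • (1 : Matrix (Fin n) (Fin n) ℝ) - Q * Matrix.diagonal l * (Qᵀ * g)) * g⁻¹
      = Q * Matrix.diagonal (fun i => (∑ j, l j) - l i) * Qᵀ := by
    have e : Matrix.diagonal (fun i => (∑ j, l j) - l i)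
        = (∑ j, l j) • (1 : Matrix (Fin n) (Fin n) ℝ) - Matrix.diagonal l := by
      rw [← Matrix.diagonal_one, ← Matrix.diagonal_smul, Matrix.diagonal_sub]
      congr 1; ext i; simp
    rw [e, hi, sub_mul, mul_sub, sub_mul]
    congr 1
    · simp
    · calc Q * Matrix.diagonal l * (Qᵀ * g) * (Q * Qᵀ)
          = Q * Matrix.diagonal l * Qᵀ * (g * (Q * Qᵀ)) := by simp only [Matrix.mul_assoc]
        _ = _ := by rw [hgi, Matrix.mul_one]
  rw [key]
  have := (Matrix.PosSemidef.diagonal (R := ℝ) (d := fun i => (∑ j, l j) - l i) hl).mul_mul_conjTranspose_same Q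
  simpa using this

end Pencil

/-! ### Calculus of partial derivatives. -/

section PartialD

variable {n : ℕ} {f g : Euc n → ℝ}

theorem contDiff_partialD (hf : ContDiff ℝ ∞ f) (i : Fin n) : ContDiff ℝ ∞ (partialD i f) :=
  (hf.fderiv_right (m := ∞) (by simp)).clm_apply contDiff_const

theorem partialD_mul (hf : ContDiff ℝ ∞ f) (hg : ContDiff ℝ ∞ g) (i : Fin n) (x : Euc n) :
    partialD i (fun y => f y * g y) x = partialD i f x * g x + f x * partialD i g x := by
  have h := (hf.differentiable (by simp) x).hasFDerivAt.mul
    (hg.differentiable (by simp) x).hasFDerivAt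
  simp only [partialD]
  rw [HasFDerivAt.fderiv (f := fun y => f y * g y) h]
  simp
  ring

theorem partialD_sub (hf : ContDiff ℝ ∞ f) (hg : ContDiff ℝ ∞ g) (i : Fin n) (x : Euc n) :
    partialD i (fun y => f y - g y) x = partialD i f x - partialD i g x := by
  simp only [partialD]
  rw [fderiv_fun_sub (hf.differentiable (by simp) x) (hg.differentiable (by simp) x)]
  simp

theorem partialD_sum {ι : Type*} (s : Finset ι) {F : ι → Euc n → ℝ}
    (hF : ∀ k, ContDiff ℝ ∞ (F k)) (i : Fin n) (x : Euc n) :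
    partialD i (fun y => ∑ k ∈ s, F k y) x = ∑ k ∈ s, partialD i (F k) x := by
  simp only [partialD]
  rw [fderiv_fun_sum fun k _ => (hF k).differentiable (by simp) x]
  simp

theorem partialD_const (c : ℝ) (i : Fin n) (x : Euc n) : partialD i (fun _ => c) x = 0 := by
  simp [partialD]

theorem partialD_comm (hf : ContDiff ℝ ∞ f) (i j : Fin n) (x : Euc n) :
    partialD i (partialD j f) x = partialD j (partialD i f) x := by
  have hd : DifferentiableAt ℝ (fderiv ℝ f) x :=
    (hf.fderiv_right (m := ∞) (by simp)).differentiable (by simp) x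
  have key : ∀ a b : Fin n, partialD a (partialD b f) x =
      fderiv ℝ (fderiv ℝ f) x (EuclideanSpace.single a 1) (EuclideanSpace.single b 1) := by
    intro a b
    have := hd.hasFDerivAt.clm_apply
      (hasFDerivAt_const (EuclideanSpace.single b (1 : ℝ)) x)
    change fderiv ℝ (fun y => fderiv ℝ f y (EuclideanSpace.single b 1)) x _ = _
    rw [this.fderiv]
    simp
  rw [key, key]
  exact (hf.contDiffAt.isSymmSndFDerivAt (by simp; norm_cast)) _ _

theorem partialD_apply {m : ℕ} {F : Euc n → Euc m} (hF : ContDiff ℝ ∞ F) (i : Fin n) (k : Fin m)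
    (x : Euc n) : partialD i F x k = partialD i (fun y => F y k) x := by
  have h := (EuclideanSpace.proj (𝕜 := ℝ) k).hasFDerivAt.comp x
    (hF.differentiable (by simp) x).hasFDerivAt
  simp only [partialD]
  rw [HasFDerivAt.fderiv (f := fun y => F y k) h]
  simp

end PartialD

/-! ### The flat divergence of `P₁Aq`. -/

section Divergence

variable {n : ℕ}

/-- The Jacobian matrix of the map with components `q i`. -/
noncomputable def jacobian (q : Fin n → Euc n → ℝ) (x : Euc n) : Matrix (Fin n) (Fin n) ℝ :=
  Matrix.of fun i j => partialD j (q i) x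

theorem contDiff_jacobian {q : Fin n → Euc n → ℝ} (hq : ∀ i, ContDiff ℝ ∞ (q i)) (i j : Fin n) :
    ContDiff ℝ ∞ fun x => jacobian q x i j :=
  contDiff_partialD (hq i) j

theorem contDiff_jacobian_trace {q : Fin n → Euc n → ℝ} (hq : ∀ i, ContDiff ℝ ∞ (q i)) :
    ContDiff ℝ ∞ fun x => (jacobian q x).trace := by
  simp only [Matrix.trace, Matrix.diag]
  exact ContDiff.sum fun i _ => contDiff_jacobian hq i i

theorem contDiff_jacobian_mulVec {q V : Fin n → Euc n → ℝ} (hq : ∀ i, ContDiff ℝ ∞ (q i))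
    (hV : ∀ i, ContDiff ℝ ∞ (V i)) (i : Fin n) :
    ContDiff ℝ ∞ fun x => (jacobian q x *ᵥ fun k => V k x) i := by
  simp only [Matrix.mulVec, dotProduct]
  exact ContDiff.sum fun k _ => (contDiff_jacobian hq i k).mul (hV k)

/-- The vector field `(tr B • 1 - B) B q`, where `B` is the Jacobian matrix of `q`. -/
noncomputable def newtonField (q : Fin n → Euc n → ℝ) (i : Fin n) (x : Euc n) : ℝ :=
  (jacobian q x).trace * (jacobian q x *ᵥ fun k => q k x) i
    - (jacobian q x *ᵥ (jacobian q x *ᵥ fun k => q k x)) i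

theorem contDiff_newtonField {q : Fin n → Euc n → ℝ} (hq : ∀ i, ContDiff ℝ ∞ (q i)) (i : Fin n) :
    ContDiff ℝ ∞ (newtonField q i) :=
  ((contDiff_jacobian_trace hq).mul (contDiff_jacobian_mulVec hq hq i)).sub
    (contDiff_jacobian_mulVec hq (contDiff_jacobian_mulVec hq hq) i)

/-- Write `B` for the Jacobian of `q`. All second derivatives of `q` cancel: `tr B • 1 - B` is
divergence free because mixed partials commute, and the terms where `B` itself is differentiated
cancel because `(tr B)² - tr B²` is constant. What is left differentiates only the factor `q`,
giving `tr ((tr B • 1 - B) B B)`. -/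
theorem sum_partialD_newtonField {q : Fin n → Euc n → ℝ} (hq : ∀ i, ContDiff ℝ ∞ (q i)) {c : ℝ}
    (hc : ∀ x, (jacobian q x).trace ^ 2 - (jacobian q x * jacobian q x).trace = c) (x : Euc n) :
    ∑ i, partialD i (newtonField q i) x =
      (jacobian q x).trace * (jacobian q x * jacobian q x).trace
        - (jacobian q x * jacobian q x * jacobian q x).trace := by
  set D : Fin n → Fin n → Fin n → ℝ := fun i j k => partialD k (fun y => jacobian q y i j) x with hD
  have hDs : ∀ i j k, D i j k = D i k j := fun i j k => partialD_comm (hq i) k j x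
  have hJ := contDiff_jacobian hq
  have hT := contDiff_jacobian_trace hq
  have hZ := contDiff_jacobian_mulVec hq hq
  have dT : ∀ k, partialD k (fun y => (jacobian q y).trace) x = ∑ i, D i i k := fun k => by
    simp only [Matrix.trace, Matrix.diag]
    exact partialD_sum _ (fun i => hJ i i) k x
  have dZ : ∀ i k, partialD i (fun y => (jacobian q y *ᵥ fun l => q l y) k) x =
      ∑ j, (D k j i * q j x + jacobian q x k j * jacobian q x j i) := fun i k => by
    simp only [Matrix.mulVec, dotProduct]
    rw [partialD_sum _ (fun j => (hJ k j).mul (hq j))]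
    exact Finset.sum_congr rfl fun j _ => partialD_mul (hJ k j) (hq j) i x
  -- Half the derivative of `hc` in direction `j`.
  have dC : ∀ j, (jacobian q x).trace * ∑ i, D i i j =
      ∑ i, ∑ k, jacobian q x i k * D k i j := fun j => by
    have h0 : partialD j (fun y => (jacobian q y).trace * (jacobian q y).trace
        - ∑ i, ∑ k, jacobian q y i k * jacobian q y k i) x = 0 := by
      rw [show (fun y => (jacobian q y).trace * (jacobian q y).trace
        - ∑ i, ∑ k, jacobian q y i k * jacobian q y k i) = fun _ => c from ?_, partialD_const]
      funext y
      rw [← hc y, pow_two]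
      rfl
    rw [partialD_sub (hT.mul hT) (ContDiff.sum fun i _ => ContDiff.sum fun k _ =>
      (hJ i k).mul (hJ k i)), partialD_mul hT hT, dT,
      partialD_sum _ (fun i => ContDiff.sum fun k _ => (hJ i k).mul (hJ k i))] at h0
    have h1 : ∀ i, partialD j (fun y => ∑ k, jacobian q y i k * jacobian q y k i) x =
        ∑ k, (D i k j * jacobian q x k i + jacobian q x i k * D k i j) := fun i => by
      rw [partialD_sum _ (fun k => (hJ i k).mul (hJ k i))]
      exact Finset.sum_congr rfl fun k _ => partialD_mul (hJ i k) (hJ k i) j x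
    simp only [h1, Finset.sum_add_distrib] at h0
    rw [Finset.sum_comm (f := fun i k => D i k j * jacobian q x k i)] at h0
    simp only [mul_comm (D _ _ _)] at h0
    linarith
  have dY : ∀ i, partialD i (newtonField q i) x =
      (∑ k, D k k i) * (jacobian q x *ᵥ fun l => q l x) i
      + (jacobian q x).trace * ∑ j, (D i j i * q j x + jacobian q x i j * jacobian q x j i)
      - ∑ k, (D i k i * (jacobian q x *ᵥ fun l => q l x) k + jacobian q x i k *
        ∑ j, (D k j i * q j x + jacobian q x k j * jacobian q x j i)) := fun i => by
    have e : newtonField q i = fun y => (jacobian q y).trace * (jacobian q y *ᵥ fun k => q k y) i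
        - ∑ k, jacobian q y i k * (jacobian q y *ᵥ fun k => q k y) k := rfl
    rw [e, partialD_sub (hT.mul (hZ i)) (ContDiff.sum fun k _ => (hJ i k).mul (hZ k)),
      partialD_mul hT (hZ i), dT, dZ, partialD_sum _ (fun k => (hJ i k).mul (hZ k))]
    congr 1
    refine Finset.sum_congr rfl fun k _ => ?_
    rw [partialD_mul (hJ i k) (hZ k), dZ]
  -- `∑ᵢ ∂ᵢBᵢₖ = ∂ₖ tr B`, by symmetry of second derivatives.
  have s1 : ∑ i, ∑ k, D i k i * (jacobian q x *ᵥ fun l => q l x) k =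
      ∑ i, (∑ k, D k k i) * (jacobian q x *ᵥ fun l => q l x) i := by
    rw [Finset.sum_comm]
    refine Finset.sum_congr rfl fun k _ => ?_
    rw [Finset.sum_mul]
    exact Finset.sum_congr rfl fun i _ => by rw [hDs]
  have s2 : ∑ i, ∑ j, D i j i * q j x = ∑ j, (∑ i, D i i j) * q j x := by
    rw [Finset.sum_comm]
    refine Finset.sum_congr rfl fun k _ => ?_
    rw [Finset.sum_mul]
    exact Finset.sum_congr rfl fun i _ => by rw [hDs]
  -- The only place where the constancy of `S₂` enters, through `dC`.
  have s3 : ∑ i, ∑ k, jacobian q x i k * ∑ j, D k j i * q j x =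
      (jacobian q x).trace * ∑ j, (∑ i, D i i j) * q j x := by
    have hr : (jacobian q x).trace * ∑ j, (∑ i, D i i j) * q j x =
        ∑ j, ∑ i, ∑ k, jacobian q x i k * (D k j i * q j x) := by
      rw [Finset.mul_sum]
      refine Finset.sum_congr rfl fun j _ => ?_
      rw [← mul_assoc, dC, Finset.sum_mul]
      refine Finset.sum_congr rfl fun i _ => ?_
      rw [Finset.sum_mul]
      exact Finset.sum_congr rfl fun k _ => by rw [hDs k i j, mul_assoc]
    rw [hr]
    symm
    rw [Finset.sum_comm]
    refine Finset.sum_congr rfl fun i _ => ?_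
    rw [Finset.sum_comm]
    exact Finset.sum_congr rfl fun k _ => (Finset.mul_sum _ _ _).symm
  have s4 : (jacobian q x * jacobian q x * jacobian q x).trace = ∑ i, ∑ k, jacobian q x i k *
      ∑ j, jacobian q x k j * jacobian q x j i := by
    rw [Matrix.mul_assoc]; rfl
  have s5 : (jacobian q x * jacobian q x).trace = ∑ i, ∑ j, jacobian q x i j * jacobian q x j i :=
    rfl
  simp only [dY, Finset.sum_sub_distrib, Finset.sum_add_distrib, mul_add]
  rw [← Finset.mul_sum, ← Finset.mul_sum, s1, s2, s3, s4, s5]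
  ring

end Divergence

/-! ### Metric and area of a graph. -/

/-- `√(1 + |∇u|²)`, the area density of the graph of `u`. -/
noncomputable def areaDensity {n : ℕ} (u : Euc n → ℝ) (x : Euc n) : ℝ :=
  Real.sqrt (1 + ∑ i, partialD i u x ^ 2)

section Graph

variable {n : ℕ} {u : Euc n → ℝ}

theorem areaDensity_radicand_pos (x : Euc n) : 0 < 1 + ∑ i, partialD i u x ^ 2 := by
  positivity

theorem areaDensity_pos (x : Euc n) : 0 < areaDensity u x :=
  Real.sqrt_pos.mpr (areaDensity_radicand_pos x)

theorem areaDensity_sq (x : Euc n) : areaDensity u x ^ 2 = 1 + ∑ i, partialD i u x ^ 2 :=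
  Real.sq_sqrt (areaDensity_radicand_pos x).le

theorem contDiff_areaDensity (hu : ContDiff ℝ ∞ u) : ContDiff ℝ ∞ (areaDensity u) :=
  (contDiff_const.add (ContDiff.sum fun i _ => (contDiff_partialD hu i).pow 2)).sqrt
    fun x => (areaDensity_radicand_pos x).ne'

theorem graphMap_castSucc (x : Euc n) (i : Fin n) : graphMap u x i.castSucc = x i := by
  simp [graphMap]

theorem graphMap_last (x : Euc n) : graphMap u x (Fin.last n) = u x := by
  simp [graphMap]

theorem contDiff_graphMap (hu : ContDiff ℝ ∞ u) : ContDiff ℝ ∞ (graphMap u) := by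
  rw [contDiff_euclidean]
  intro i
  refine Fin.lastCases ?_ (fun j => ?_) i
  · simpa only [graphMap_last] using hu
  · simp only [graphMap_castSucc]
    exact (EuclideanSpace.proj (𝕜 := ℝ) j).contDiff

theorem partialD_coord (i j : Fin n) (x : Euc n) :
    partialD i (fun y : Euc n => y j) x = (1 : Matrix (Fin n) (Fin n) ℝ) i j := by
  have : (fun y : Euc n => y j) = EuclideanSpace.proj (𝕜 := ℝ) j := rfl
  rw [partialD, this, ContinuousLinearMap.fderiv]
  simp [Matrix.one_apply, eq_comm]

theorem inner_partialD_graphMap (hu : ContDiff ℝ ∞ u) (i : Fin n) (x : Euc n) (v : Euc (n + 1)) :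
    inner ℝ (partialD i (graphMap u) x) v
      = v i.castSucc + partialD i u x * v (Fin.last n) := by
  rw [PiLp.inner_apply, Fin.sum_univ_castSucc]
  simp only [partialD_apply (contDiff_graphMap hu), graphMap_castSucc, graphMap_last,
    partialD_coord]
  simp [Matrix.one_apply, mul_comm]

theorem metric_graphMap (hu : ContDiff ℝ ∞ u) (x : Euc n) (i j : Fin n) :
    metric (graphMap u) x i j =
      (1 : Matrix (Fin n) (Fin n) ℝ) i j + partialD i u x * partialD j u x := by
  simp only [metric, Matrix.of_apply, inner_partialD_graphMap hu,
    partialD_apply (contDiff_graphMap hu), graphMap_castSucc, graphMap_last, partialD_coord]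
  simp [Matrix.one_apply, eq_comm]

theorem metric_graphMap_eq (hu : ContDiff ℝ ∞ u) (x : Euc n) :
    metric (graphMap u) x =
      1 + Matrix.vecMulVec (fun i => partialD i u x) (fun i => partialD i u x) := by
  ext i j
  rw [metric_graphMap hu, Matrix.add_apply, Matrix.vecMulVec_apply]

theorem posDef_metric_graphMap (hu : ContDiff ℝ ∞ u) (x : Euc n) :
    (metric (graphMap u) x).PosDef := by
  rw [metric_graphMap_eq hu]
  exact Matrix.PosDef.one.add_posSemidef
    (by simpa using Matrix.posSemidef_vecMulVec_self_star (fun i => partialD i u x))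

theorem det_metric_graphMap (hu : ContDiff ℝ ∞ u) (x : Euc n) :
    (metric (graphMap u) x).det = areaDensity u x ^ 2 := by
  rw [metric_graphMap_eq hu, areaDensity_sq, Matrix.vecMulVec_eq Unit,
    Matrix.det_one_add_replicateCol_mul_replicateRow]
  simp [dotProduct, pow_two]

theorem metric_graphMap_mulVec_gradient (hu : ContDiff ℝ ∞ u) (x : Euc n) :
    metric (graphMap u) x *ᵥ (fun i => partialD i u x)
      = areaDensity u x ^ 2 • fun i => partialD i u x := by
  rw [metric_graphMap_eq hu, areaDensity_sq, Matrix.add_mulVec, Matrix.one_mulVec]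
  ext i
  simp [Matrix.mulVec, dotProduct, Matrix.vecMulVec_apply, mul_assoc, ← Finset.mul_sum, pow_two]
  ring

theorem integral_areaMeasure_graphMap (hu : ContDiff ℝ ∞ u) (F : Euc n → ℝ) :
    ∫ x, F x ∂(areaMeasure (graphMap u)) = ∫ x, areaDensity u x * F x := by
  have h : ∀ x, Real.sqrt (metric (graphMap u) x).det = areaDensity u x := fun x => by
    rw [det_metric_graphMap hu, Real.sqrt_sq (areaDensity_pos x).le]
  rw [areaMeasure]
  simp only [h]
  rw [integral_withDensity_eq_integral_toReal_smul
    (contDiff_areaDensity hu).continuous.measurable.ennreal_ofReal (by simp)]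
  simp [ENNReal.toReal_ofReal (areaDensity_pos _).le]

end Graph

/-! ### Unit normal and shape operator of a graph. -/

section Normal

variable {n : ℕ} {u : Euc n → ℝ} {N : Euc n → Euc (n + 1)}

/-- The horizontal components of `-N`. -/
def horizontalPart (N : Euc n → Euc (n + 1)) (i : Fin n) (x : Euc n) : ℝ := -N x i.castSucc

theorem IsUnitNormalField.neg {X : Euc n → Euc (n + 1)} (hN : IsUnitNormalField X N) :
    IsUnitNormalField X (-N) :=
  ⟨hN.smooth.neg, fun x => by simpa using hN.norm_eq_one x,
    fun x v => by simpa using hN.normal x v⟩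

theorem contDiff_horizontalPart {X : Euc n → Euc (n + 1)} (hN : IsUnitNormalField X N)
    (i : Fin n) : ContDiff ℝ ∞ (horizontalPart N i) :=
  ((contDiff_euclidean.mp hN.smooth) i.castSucc).neg

theorem horizontalPart_eq (hu : ContDiff ℝ ∞ u) (hN : IsUnitNormalField (graphMap u) N)
    (i : Fin n) (x : Euc n) : horizontalPart N i x = N x (Fin.last n) * partialD i u x := by
  have h := hN.normal x (EuclideanSpace.single i 1)
  rw [real_inner_comm] at h
  have h' := inner_partialD_graphMap hu i x (N x)
  rw [partialD, h] at h'
  rw [horizontalPart]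
  linarith

theorem sum_sq_components (hN : IsUnitNormalField (graphMap u) N) (x : Euc n) :
    ∑ i, horizontalPart N i x ^ 2 + N x (Fin.last n) ^ 2 = 1 := by
  have h := hN.norm_eq_one x
  have h2 : ‖N x‖ ^ 2 = 1 := by rw [h]; norm_num
  rw [EuclideanSpace.norm_sq_eq, Fin.sum_univ_castSucc] at h2
  simpa [horizontalPart] using h2

/-- The vertical component of a unit normal field is `±1/√(1 + |∇u|²)`, with a global sign. -/
theorem exists_sign (hu : ContDiff ℝ ∞ u) (hN : IsUnitNormalField (graphMap u) N) :
    ∃ s : ℝ, s ^ 2 = 1 ∧ ∀ x, N x (Fin.last n) * areaDensity u x = s := by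
  have hsq : ∀ x, (N x (Fin.last n) * areaDensity u x) ^ 2 = 1 := fun x => by
    have h := sum_sq_components hN x
    simp only [horizontalPart_eq hu hN, mul_pow, ← Finset.mul_sum] at h
    rw [mul_pow, areaDensity_sq]
    linarith
  have hc : Continuous fun x => N x (Fin.last n) * areaDensity u x :=
    ((contDiff_euclidean.mp hN.smooth) (Fin.last n)).continuous.mul
      (contDiff_areaDensity hu).continuous
  -- A continuous function with square `1` on the connected space `ℝⁿ` is constant.
  rcases isPreconnected_univ.eq_or_eq_neg_of_sq_eq (f := fun x => N x (Fin.last n) * areaDensity u x)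
    (g := fun _ => (1 : ℝ)) hc.continuousOn continuousOn_const
    (fun x _ => by simpa using hsq x) (by simp) with h | h
  · exact ⟨1, by norm_num, fun x => h (Set.mem_univ x)⟩
  · exact ⟨-1, by norm_num, fun x => by simpa using h (Set.mem_univ x)⟩

theorem vertical_ne_zero (hu : ContDiff ℝ ∞ u) (hN : IsUnitNormalField (graphMap u) N)
    (x : Euc n) : N x (Fin.last n) ≠ 0 := by
  obtain ⟨s, hs, h⟩ := exists_sign hu hN
  intro h0
  rw [← h x, h0] at hs
  norm_num at hs

/-- Differentiate `|q|² + ν² = 1`, substitute `q = ν∇u` and divide by `2ν`. -/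
theorem partialD_vertical (hu : ContDiff ℝ ∞ u) (hN : IsUnitNormalField (graphMap u) N)
    (j : Fin n) (x : Euc n) : partialD j (fun y => N y (Fin.last n)) x =
      -∑ k, partialD k u x * jacobian (horizontalPart N) x k j := by
  have hq := contDiff_horizontalPart hN
  have hv := (contDiff_euclidean.mp hN.smooth) (Fin.last n)
  have h0 : partialD j (fun y => (∑ i, horizontalPart N i y * horizontalPart N i y)
      - (1 - N y (Fin.last n) * N y (Fin.last n))) x = 0 := by
    rw [show (fun y => (∑ i, horizontalPart N i y * horizontalPart N i y)
      - (1 - N y (Fin.last n) * N y (Fin.last n))) = fun _ => 0 from ?_, partialD_const]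
    funext y
    have := sum_sq_components hN y
    simp only [pow_two] at this
    linarith
  rw [partialD_sub (ContDiff.sum fun i _ => (hq i).mul (hq i)) (contDiff_const.sub (hv.mul hv)),
    partialD_sub contDiff_const (hv.mul hv), partialD_const, partialD_mul hv hv,
    partialD_sum _ fun i => (hq i).mul (hq i)] at h0
  simp only [fun i => partialD_mul (hq i) (hq i) j x, horizontalPart_eq hu hN _ x] at h0
  have e : ∑ k, (partialD j (horizontalPart N k) x * (N x (Fin.last n) * partialD k u x)
      + N x (Fin.last n) * partialD k u x * partialD j (horizontalPart N k) x) =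
      2 * N x (Fin.last n) * ∑ k, partialD k u x * jacobian (horizontalPart N) x k j := by
    rw [Finset.mul_sum]
    refine Finset.sum_congr rfl fun k _ => ?_
    rw [jacobian, Matrix.of_apply]
    ring
  rw [e] at h0
  have hne := vertical_ne_zero hu hN x
  apply mul_left_cancel₀ hne
  linarith

theorem secondForm_graphMap (hu : ContDiff ℝ ∞ u) (hN : IsUnitNormalField (graphMap u) N)
    (x : Euc n) (i j : Fin n) : secondForm (graphMap u) N x i j =
      jacobian (horizontalPart N) x i j
        - partialD i u x * partialD j (fun y => N y (Fin.last n)) x := by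
  rw [secondForm, Matrix.of_apply, inner_partialD_graphMap hu]
  simp only [PiLp.neg_apply, partialD_apply hN.smooth]
  have : partialD j (horizontalPart N i) x = -partialD j (fun y => N y i.castSucc) x := by
    have e : horizontalPart N i = fun y => -N y i.castSucc := rfl
    rw [e, partialD, fderiv_fun_neg]
    rfl
  rw [jacobian, Matrix.of_apply, this]
  ring

/-- In the derivative of `q = ν∇u` the term containing `∂ν` cancels. This form makes the symmetry of
`h` evident. -/
theorem secondForm_graphMap_eq_hessian (hu : ContDiff ℝ ∞ u)
    (hN : IsUnitNormalField (graphMap u) N) (x : Euc n) (i j : Fin n) :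
    secondForm (graphMap u) N x i j = N x (Fin.last n) * partialD j (partialD i u) x := by
  have hv := (contDiff_euclidean.mp hN.smooth) (Fin.last n)
  have h : partialD j (horizontalPart N i) x = _ :=
    (congrArg (fun f => partialD j f x) (funext (horizontalPart_eq hu hN i))).trans
      (partialD_mul hv (contDiff_partialD hu i) j x)
  rw [secondForm_graphMap hu hN, jacobian, Matrix.of_apply, h]
  ring

theorem secondForm_graphMap_transpose (hu : ContDiff ℝ ∞ u)
    (hN : IsUnitNormalField (graphMap u) N) (x : Euc n) :
    (secondForm (graphMap u) N x)ᵀ = secondForm (graphMap u) N x := by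
  ext i j
  rw [Matrix.transpose_apply, secondForm_graphMap_eq_hessian hu hN,
    secondForm_graphMap_eq_hessian hu hN, partialD_comm hu]

/-- The shape operator of a graph is the Jacobian of the horizontal part of the normal field. -/
theorem shapeOp_graphMap (hu : ContDiff ℝ ∞ u) (hN : IsUnitNormalField (graphMap u) N)
    (x : Euc n) : shapeOp (graphMap u) N x = jacobian (horizontalPart N) x := by
  have hd : IsUnit (metric (graphMap u) x).det :=
    (Matrix.isUnit_iff_isUnit_det _).mp (posDef_metric_graphMap hu x).isUnit
  -- Writing `G = ∂u` and `J` for the Jacobian of `q`, the formula for `∂ν` turns `J - G(∂ν)ᵀ` into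
  -- `(1 + GGᵀ)J`.
  have h : secondForm (graphMap u) N x =
      metric (graphMap u) x * jacobian (horizontalPart N) x := by
    ext i j
    rw [secondForm_graphMap hu hN, partialD_vertical hu hN, metric_graphMap_eq hu, add_mul, one_mul,
      Matrix.add_apply, Matrix.mul_apply]
    simp only [Matrix.vecMulVec_apply, mul_assoc, ← Finset.mul_sum]
    ring
  rw [shapeOp, h, Matrix.nonsing_inv_mul_cancel_left _ _ hd]

end Normal

/-! ### The stability inequality. -/

section Stability

variable {n : ℕ} {u : Euc n → ℝ} {N : Euc n → Euc (n + 1)}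

theorem symCurv_one_graphMap (hu : ContDiff ℝ ∞ u) (hN : IsUnitNormalField (graphMap u) N)
    (x : Euc n) : symCurv 1 (graphMap u) N x = (jacobian (horizontalPart N) x).trace := by
  rw [← shapeOp_graphMap hu hN]
  exact esymm_one_eq_trace (posDef_metric_graphMap hu x) (secondForm_graphMap_transpose hu hN x) rfl

theorem two_mul_symCurv_two_graphMap (hu : ContDiff ℝ ∞ u) (hN : IsUnitNormalField (graphMap u) N)
    (x : Euc n) : 2 * symCurv 2 (graphMap u) N x = (jacobian (horizontalPart N) x).trace ^ 2
      - (jacobian (horizontalPart N) x * jacobian (horizontalPart N) x).trace := by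
  rw [← shapeOp_graphMap hu hN]
  exact two_mul_esymm_two_eq_trace (posDef_metric_graphMap hu x)
    (secondForm_graphMap_transpose hu hN x) rfl

theorem potential_graphMap (hu : ContDiff ℝ ∞ u) (hN : IsUnitNormalField (graphMap u) N)
    (x : Euc n) :
    symCurv 1 (graphMap u) N x * symCurv 2 (graphMap u) N x - 3 * symCurv 3 (graphMap u) N x =
      (jacobian (horizontalPart N) x).trace
          * (jacobian (horizontalPart N) x * jacobian (horizontalPart N) x).trace
        - (jacobian (horizontalPart N) x * jacobian (horizontalPart N) x
          * jacobian (horizontalPart N) x).trace := by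
  rw [← shapeOp_graphMap hu hN]
  exact esymm_potential_eq_trace (posDef_metric_graphMap hu x)
    (secondForm_graphMap_transpose hu hN x) rfl

theorem newton_one {X : Euc n → Euc (n + 1)} (x : Euc n) :
    newton X N x 1 = symCurv 1 X N x • 1 - shapeOp X N x := by
  simp [newton]

theorem symCurv_one_neg (hu : ContDiff ℝ ∞ u) (hN : IsUnitNormalField (graphMap u) N)
    (x : Euc n) : symCurv 1 (graphMap u) (-N) x = -symCurv 1 (graphMap u) N x := by
  have e : ∀ i, horizontalPart (-N) i = -horizontalPart N i := fun i => by
    funext y; simp [horizontalPart]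
  rw [symCurv_one_graphMap hu hN, symCurv_one_graphMap hu hN.neg, ← Matrix.trace_neg]
  congr 1
  ext i j
  simp [jacobian, partialD, e, fderiv_neg]

theorem symCurv_two_neg (hu : ContDiff ℝ ∞ u) (hN : IsUnitNormalField (graphMap u) N)
    (x : Euc n) : symCurv 2 (graphMap u) (-N) x = symCurv 2 (graphMap u) N x := by
  have e : ∀ i, horizontalPart (-N) i = -horizontalPart N i := fun i => by
    funext y; simp [horizontalPart]
  have ej : jacobian (horizontalPart (-N)) x = -jacobian (horizontalPart N) x := by
    ext i j
    simp [jacobian, partialD, e, fderiv_neg]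
  have h1 := two_mul_symCurv_two_graphMap hu hN x
  have h2 := two_mul_symCurv_two_graphMap hu hN.neg x
  rw [ej, neg_mul_neg, Matrix.trace_neg, neg_sq] at h2
  linarith

/-- The matrix `P₁ g⁻¹` of the quadratic form `⟨P₁ ∇f, ∇f⟩` in terms of `∂f`. -/
noncomputable def newtonForm (X N : Euc n → Euc (n + 1)) (x : Euc n) :
    Matrix (Fin n) (Fin n) ℝ :=
  newton X N x 1 * (metric X x)⁻¹

theorem metricInner_newton_grad (hu : ContDiff ℝ ∞ u) (f : Euc n → ℝ) (x : Euc n) :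
    metricInner (graphMap u) x (newton (graphMap u) N x 1 *ᵥ grad (graphMap u) f x)
        (grad (graphMap u) f x) =
      (fun i => partialD i f x) ⬝ᵥ (newtonForm (graphMap u) N x *ᵥ fun i => partialD i f x) := by
  have hd : IsUnit (metric (graphMap u) x).det :=
    (Matrix.isUnit_iff_isUnit_det _).mp (posDef_metric_graphMap hu x).isUnit
  rw [metricInner, grad, Matrix.mulVec_mulVec, Matrix.mulVec_mulVec, Matrix.mul_nonsing_inv _ hd,
    Matrix.one_mulVec, dotProduct_comm, newtonForm]

theorem posSemidef_newtonForm (hu : ContDiff ℝ ∞ u) (hN : IsUnitNormalField (graphMap u) N)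
    {x : Euc n} (h1 : 0 ≤ symCurv 1 (graphMap u) N x) (h2 : 0 ≤ symCurv 2 (graphMap u) N x) :
    (newtonForm (graphMap u) N x).PosSemidef := by
  rw [newtonForm, newton_one]
  exact posSemidef_newton_one (posDef_metric_graphMap hu x)
    (secondForm_graphMap_transpose hu hN x) rfl h1 h2

theorem transpose_metric (X : Euc n → Euc (n + 1)) (x : Euc n) : (metric X x)ᵀ = metric X x := by
  ext i j
  simp [metric, real_inner_comm]

/-- `P₁ ∇⟨N, e⟩ = -⟨N, e⟩ P₁ A q`, where `q` is the horizontal part of `-N`. -/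
theorem newtonForm_mulVec_vertical (hu : ContDiff ℝ ∞ u) (hN : IsUnitNormalField (graphMap u) N)
    (x : Euc n) :
    newtonForm (graphMap u) N x *ᵥ (fun i => partialD i (fun y => N y (Fin.last n)) x) =
      -(N x (Fin.last n)) • fun i => newtonField (horizontalPart N) i x := by
  obtain ⟨s, hs, hsx⟩ := exists_sign hu hN
  set G : Fin n → ℝ := fun i => partialD i u x with hG
  set A := shapeOp (graphMap u) N x with hA
  set g := metric (graphMap u) x with hg
  set v := N x (Fin.last n) with hv
  have hvw : v ^ 2 * areaDensity u x ^ 2 = 1 := by rw [← mul_pow, hsx, hs]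
  have hd : IsUnit g.det := (Matrix.isUnit_iff_isUnit_det _).mp (posDef_metric_graphMap hu x).isUnit
  have hb : (fun i => partialD i (fun y => N y (Fin.last n)) x) = -(Aᵀ *ᵥ G) := by
    funext i
    rw [partialD_vertical hu hN, hA, shapeOp_graphMap hu hN]
    simp [Matrix.mulVec, dotProduct, hG, mul_comm]
  -- `G` is an eigenvector of `g` with eigenvalue `W² = ν⁻²`.
  have hgG : g⁻¹ *ᵥ G = v ^ 2 • G := by
    have h := metric_graphMap_mulVec_gradient hu x
    have h' : G = areaDensity u x ^ 2 • (g⁻¹ *ᵥ G) := by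
      rw [← Matrix.mulVec_smul, ← h, Matrix.mulVec_mulVec, Matrix.nonsing_inv_mul _ hd,
        Matrix.one_mulVec]
    conv_rhs => rw [h', smul_smul, hvw, one_smul]
  -- Self-adjointness of `A` for `g`; it gives `P₁g⁻¹∂ν = -P₁g⁻¹AᵀG = -P₁Ag⁻¹G = -ν²P₁AG`, and `νG =
  -- q`.
  have hcomm : g⁻¹ * Aᵀ = A * g⁻¹ := by
    rw [hA, shapeOp, Matrix.transpose_mul, secondForm_graphMap_transpose hu hN,
      Matrix.transpose_nonsing_inv, transpose_metric, ← Matrix.mul_assoc]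
  have hq : (fun i => horizontalPart N i x) = v • G := by
    funext i
    rw [horizontalPart_eq hu hN]
    rfl
  have hY : (fun i => newtonField (horizontalPart N) i x)
      = newton (graphMap u) N x 1 *ᵥ (A *ᵥ (v • G)) := by
    rw [newton_one, symCurv_one_graphMap hu hN, ← hA, ← hq, Matrix.sub_mulVec, Matrix.smul_mulVec,
      Matrix.one_mulVec, hA, shapeOp_graphMap hu hN]
    rfl
  rw [hY, hb, newtonForm, ← hg, Matrix.mulVec_neg, Matrix.mulVec_mulVec, Matrix.mul_assoc, hcomm,
    ← Matrix.mulVec_mulVec, ← Matrix.mulVec_mulVec, hgG, Matrix.mulVec_smul, Matrix.mulVec_smul,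
    Matrix.mulVec_smul, Matrix.mulVec_smul, smul_smul, neg_mul, ← pow_two, neg_smul]

/-- The quadratic form of `M` is nonnegative at `p - c • b`. -/
theorem posSemidef_completing_square {M : Matrix (Fin n) (Fin n) ℝ} (hM : M.PosSemidef)
    (p b : Fin n → ℝ) (c : ℝ) :
    2 * c * (p ⬝ᵥ (M *ᵥ b)) - c ^ 2 * (b ⬝ᵥ (M *ᵥ b)) ≤ p ⬝ᵥ (M *ᵥ p) := by
  have h := hM.dotProduct_mulVec_nonneg (p - c • b)
  have hs : b ⬝ᵥ (M *ᵥ p) = p ⬝ᵥ (M *ᵥ b) := by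
    have ht : Mᵀ = M := by simpa using hM.isHermitian.eq
    rw [Matrix.dotProduct_mulVec, ← Matrix.mulVec_transpose, ht, dotProduct_comm]
  simp only [star_trivial, Matrix.mulVec_sub, Matrix.mulVec_smul, sub_dotProduct, dotProduct_sub,
    smul_dotProduct, dotProduct_smul, smul_eq_mul, hs] at h
  linarith

/-- The product `νW` is constant. -/
theorem partialD_areaDensity (hu : ContDiff ℝ ∞ u) (hN : IsUnitNormalField (graphMap u) N)
    (i : Fin n) (x : Euc n) : partialD i (areaDensity u) x =
      -(areaDensity u x / N x (Fin.last n)) * partialD i (fun y => N y (Fin.last n)) x := by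
  obtain ⟨s, -, hs⟩ := exists_sign hu hN
  have hv := (contDiff_euclidean.mp hN.smooth) (Fin.last n)
  have h := partialD_mul hv (contDiff_areaDensity hu) i x
  rw [funext hs, partialD_const] at h
  have hne := vertical_ne_zero hu hN x
  field_simp
  linarith

/-- The pointwise inequality behind stability. -/
theorem neg_sum_partialD_mul_newtonField_le (hu : ContDiff ℝ ∞ u)
    (hN : IsUnitNormalField (graphMap u) N) {x : Euc n}
    (h1 : 0 ≤ symCurv 1 (graphMap u) N x) (h2 : 0 ≤ symCurv 2 (graphMap u) N x)
    {f : Euc n → ℝ} (hf : ContDiff ℝ ∞ f) :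
    -∑ i, partialD i (fun y => f y * f y * areaDensity u y) x * newtonField (horizontalPart N) i x
      ≤ areaDensity u x * ((fun i => partialD i f x) ⬝ᵥ
        (newtonForm (graphMap u) N x *ᵥ fun i => partialD i f x)) := by
  have hne := vertical_ne_zero hu hN x
  -- With `b = ∂ν` and `c = f/ν`, the vector `p - c • b` is `ν ∂(f/ν)`.
  have h := posSemidef_completing_square (posSemidef_newtonForm hu hN h1 h2)
    (fun i => partialD i f x) (fun i => partialD i (fun y => N y (Fin.last n)) x)
    (f x / N x (Fin.last n))
  rw [newtonForm_mulVec_vertical hu hN, dotProduct_smul, dotProduct_smul] at h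
  refine le_trans (le_of_eq ?_) (mul_le_mul_of_nonneg_left h (areaDensity_pos x).le)
  have e : ∀ i, partialD i (fun y => f y * f y * areaDensity u y) x =
      2 * f x * areaDensity u x * partialD i f x - f x ^ 2 * (areaDensity u x / N x (Fin.last n))
        * partialD i (fun y => N y (Fin.last n)) x := fun i => by
    rw [partialD_mul (hf.mul hf) (contDiff_areaDensity hu), partialD_mul hf hf,
      partialD_areaDensity hu hN]
    ring
  simp only [e]
  simp only [sub_mul, Finset.sum_sub_distrib, mul_assoc, ← Finset.mul_sum]
  simp only [dotProduct, smul_eq_mul]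
  field_simp
  ring

theorem hasCompactSupport_of_eq_zero {f g : Euc n → ℝ} (hf : HasCompactSupport f)
    (h : ∀ x, f x = 0 → (∀ i, partialD i f x = 0) → g x = 0) : HasCompactSupport g :=
  HasCompactSupport.intro hf fun x hx => h x (image_eq_zero_of_notMem_tsupport hx) fun i => by
    rw [partialD, fderiv_of_notMem_tsupport ℝ hx]; rfl

/-- Integration by parts against a compactly supported function. -/
theorem integral_mul_divergence {F : Euc n → ℝ} {Y : Fin n → Euc n → ℝ} (hF : ContDiff ℝ ∞ F)
    (hFc : HasCompactSupport F) (hY : ∀ i, ContDiff ℝ ∞ (Y i)) :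
    ∫ x, F x * ∑ i, partialD i (Y i) x = ∫ x, -∑ i, partialD i F x * Y i x := by
  have i1 : ∀ i, Integrable fun x => partialD i F x * Y i x := fun i =>
    ((contDiff_partialD hF i).continuous.mul (hY i).continuous).integrable_of_hasCompactSupport
      (hasCompactSupport_of_eq_zero hFc fun x _ h => by simp [h])
  have i2 : ∀ i, Integrable fun x => F x * partialD i (Y i) x := fun i =>
    (hF.continuous.mul (contDiff_partialD (hY i) i).continuous).integrable_of_hasCompactSupport
      (hasCompactSupport_of_eq_zero hFc fun x h _ => by simp [h])
  have i3 : ∀ i, Integrable fun x => F x * Y i x := fun i =>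
    (hF.continuous.mul (hY i).continuous).integrable_of_hasCompactSupport
      (hasCompactSupport_of_eq_zero hFc fun x h _ => by simp [h])
  simp only [Finset.mul_sum]
  rw [integral_finsetSum _ fun i _ => i2 i, integral_neg, integral_finsetSum _ fun i _ => i1 i,
    ← Finset.sum_neg_distrib]
  exact Finset.sum_congr rfl fun i _ => integral_mul_fderiv_eq_neg_fderiv_mul_of_integrable
    (i1 i) (i2 i) (i3 i) (fun x _ => hF.differentiable (by simp) x)
    (fun x _ => (hY i).differentiable (by simp) x)

/-- Serves the integrability of the energy density. -/
theorem continuous_newtonForm (hu : ContDiff ℝ ∞ u) (hN : IsUnitNormalField (graphMap u) N) :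
    Continuous fun x => newtonForm (graphMap u) N x := by
  have hq := contDiff_horizontalPart hN
  have hg : Continuous fun x => metric (graphMap u) x := by
    refine continuous_matrix fun i j => ?_
    simp only [metric_graphMap hu]
    exact continuous_const.add
      ((contDiff_partialD hu i).continuous.mul (contDiff_partialD hu j).continuous)
  have hgi : Continuous fun x => (metric (graphMap u) x)⁻¹ := by
    simp only [Matrix.inv_def, Ring.inverse_eq_inv', det_metric_graphMap hu]
    exact (((contDiff_areaDensity hu).continuous.pow 2).inv₀
      fun x => (pow_pos (areaDensity_pos x) 2).ne').smul hg.matrix_adjugate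
  have hJ : Continuous fun x => jacobian (horizontalPart N) x :=
    continuous_matrix fun i j => (contDiff_jacobian hq i j).continuous
  simp only [newtonForm, newton_one, symCurv_one_graphMap hu hN, shapeOp_graphMap hu hN]
  exact (((contDiff_jacobian_trace hq).continuous.smul continuous_const).sub hJ).mul hgi

/-- A graph with `S₁ ≥ 0` and `S₂` a nonnegative constant satisfies the stability inequality. -/
theorem isStronglyStable_graphMap (hu : ContDiff ℝ ∞ u) (hN : IsUnitNormalField (graphMap u) N)
    (h1 : ∀ x, 0 ≤ symCurv 1 (graphMap u) N x) {c : ℝ} (hc : 0 ≤ c)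
    (h2 : ∀ x, symCurv 2 (graphMap u) N x = c) : IsStronglyStable (graphMap u) N := by
  intro f hf hfc
  have hq := contDiff_horizontalPart hN
  have hw := contDiff_areaDensity hu
  have hF : ContDiff ℝ ∞ fun y => f y * f y * areaDensity u y := (hf.mul hf).mul hw
  have hFc : HasCompactSupport fun y => f y * f y * areaDensity u y :=
    hasCompactSupport_of_eq_zero hfc fun x h _ => by simp [h]
  -- The factor is `2` because `(tr A)² - tr A² = 2S₂`.
  have hdiv := sum_partialD_newtonField hq (c := 2 * c) fun x => by
    rw [← two_mul_symCurv_two_graphMap hu hN, h2]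
  have hp : Continuous fun x => fun i : Fin n => partialD i f x :=
    continuous_pi fun i => (contDiff_partialD hf i).continuous
  have hpot : ∀ x, areaDensity u x * ((symCurv 1 (graphMap u) N x * symCurv 2 (graphMap u) N x
      - 3 * symCurv 3 (graphMap u) N x) * f x ^ 2) =
      f x * f x * areaDensity u x * ∑ i, partialD i (newtonField (horizontalPart N) i) x :=
    fun x => by
      rw [hdiv, potential_graphMap hu hN]
      ring
  rw [newtonEnergy, integral_areaMeasure_graphMap hu, integral_areaMeasure_graphMap hu]
  simp only [hpot, metricInner_newton_grad hu]
  rw [integral_mul_divergence hF hFc fun i => contDiff_newtonField hq i]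
  refine integral_mono ?_ ?_ fun x =>
    neg_sum_partialD_mul_newtonField_le hu hN (h1 x) (by rw [h2]; exact hc) hf
  · refine (continuous_finsetSum _ fun i _ => (contDiff_partialD hF i).continuous.mul
      (contDiff_newtonField hq i).continuous).neg.integrable_of_hasCompactSupport ?_
    exact hasCompactSupport_of_eq_zero hFc fun x _ h => by simp [h]
  · refine (hw.continuous.mul (hp.dotProduct
      ((continuous_newtonForm hu hN).matrix_mulVec hp))).integrable_of_hasCompactSupport ?_
    refine hasCompactSupport_of_eq_zero hfc fun x _ h => ?_
    simp [dotProduct, h]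

theorem IsStronglyStable.isStable {X : Euc n → Euc (n + 1)} (h : IsStronglyStable X N)
    (h2 : ∀ x, symCurv 2 X N x = 0) : IsStable X N := by
  intro f hf hfc
  have := h f hf hfc
  simp only [h2, mul_zero, zero_sub] at this
  rw [← integral_const_mul]
  simpa only [neg_mul, mul_assoc] using this

/-! ### Sign of `S₁` and choice of orientation. -/

/-- `S₁² = tr A² + 2S₂ > 0`, so the continuous function `S₁` has no zero on the connected space
`ℝⁿ`. -/
theorem symCurv_one_nonneg_or_nonpos (hu : ContDiff ℝ ∞ u) (hN : IsUnitNormalField (graphMap u) N)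
    (h2 : ∀ x, 0 < symCurv 2 (graphMap u) N x) :
    (∀ x, 0 ≤ symCurv 1 (graphMap u) N x) ∨ (∀ x, symCurv 1 (graphMap u) N x ≤ 0) := by
  have hne : ∀ x, symCurv 1 (graphMap u) N x ≠ 0 := fun x h0 => by
    have h := two_mul_symCurv_two_graphMap hu hN x
    have hp := trace_mul_self_nonneg (posDef_metric_graphMap hu x)
      (secondForm_graphMap_transpose hu hN x) (A := shapeOp (graphMap u) N x) rfl
    rw [shapeOp_graphMap hu hN] at hp
    rw [← symCurv_one_graphMap hu hN, h0] at h
    have := h2 x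
    linarith
  have hc : Continuous fun x => symCurv 1 (graphMap u) N x := by
    simp only [symCurv_one_graphMap hu hN]
    exact (contDiff_jacobian_trace (contDiff_horizontalPart hN)).continuous
  by_contra! hcon
  obtain ⟨⟨a, ha⟩, b, hb⟩ := hcon
  obtain ⟨x, hx⟩ := mem_range_of_exists_le_of_exists_ge hc ⟨a, ha.le⟩ ⟨b, hb.le⟩
  exact hne x hx

/-- If `S₂` is a nonnegative constant and `S₁` does not change sign, the graph is strongly stable
for one of its two orientations. -/
theorem exists_orientation (hu : ContDiff ℝ ∞ u) (hN : IsUnitNormalField (graphMap u) N)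
    {c : ℝ} (hc : 0 ≤ c) (h2 : ∀ x, symCurv 2 (graphMap u) N x = c)
    (h1 : (∀ x, 0 ≤ symCurv 1 (graphMap u) N x) ∨ (∀ x, symCurv 1 (graphMap u) N x ≤ 0)) :
    ∃ N' : Euc n → Euc (n + 1), (N' = N ∨ N' = -N) ∧
      (∀ x, 0 ≤ symCurv 1 (graphMap u) N' x) ∧ (∀ x, symCurv 2 (graphMap u) N' x = c) ∧
      IsStronglyStable (graphMap u) N' := by
  rcases h1 with h | h
  · exact ⟨N, Or.inl rfl, h, h2, isStronglyStable_graphMap hu hN h hc h2⟩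
  · have h' : ∀ x, 0 ≤ symCurv 1 (graphMap u) (-N) x := fun x => by
      rw [symCurv_one_neg hu hN]
      exact neg_nonneg.mpr (h x)
    have h2' : ∀ x, symCurv 2 (graphMap u) (-N) x = c := fun x => by
      rw [symCurv_two_neg hu hN, h2]
    exact ⟨-N, Or.inr rfl, h', h2', isStronglyStable_graphMap hu hN.neg h' hc h2'⟩

end Stability

end GraphStability

theorem mainTheorem6 (n : ℕ) (u : GraphStability.Euc n → ℝ) (hu : ContDiff ℝ ∞ u)
    (N : GraphStability.Euc n → GraphStability.Euc (n + 1))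
    (hN : GraphStability.IsUnitNormalField (GraphStability.graphMap u) N) :
    ((∀ x, GraphStability.symCurv 2 (GraphStability.graphMap u) N x = 0) →
      ((∀ x, 0 ≤ GraphStability.symCurv 1 (GraphStability.graphMap u) N x) ∨
        (∀ x, GraphStability.symCurv 1 (GraphStability.graphMap u) N x ≤ 0)) →
      ∃ N' : GraphStability.Euc n → GraphStability.Euc (n + 1), (N' = N ∨ N' = -N) ∧
        (∀ x, 0 ≤ GraphStability.symCurv 1 (GraphStability.graphMap u) N' x) ∧
        GraphStability.IsStable (GraphStability.graphMap u) N') ∧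
    (∀ C : ℝ, 0 < C →
      (∀ x, GraphStability.symCurv 2 (GraphStability.graphMap u) N x = C) →
      ∃ N' : GraphStability.Euc n → GraphStability.Euc (n + 1), (N' = N ∨ N' = -N) ∧
        (∀ x, 0 ≤ GraphStability.symCurv 1 (GraphStability.graphMap u) N' x) ∧
        GraphStability.IsStronglyStable (GraphStability.graphMap u) N') := by
  refine ⟨fun h2 h1 => ?_, fun C hC h2 => ?_⟩
  · obtain ⟨N', hN', hpos, h2', hst⟩ := GraphStability.exists_orientation hu hN le_rfl h2 h1
    exact ⟨N', hN', hpos, hst.isStable h2'⟩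
  · obtain ⟨N', hN', hpos, -, hst⟩ := GraphStability.exists_orientation hu hN hC.le h2
      (GraphStability.symCurv_one_nonneg_or_nonpos hu hN fun x => by rw [h2]; exact hC)
    exact ⟨N', hN', hpos, hst⟩
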